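/- Let $k>4$ and $n\ge 1$ be integers and put $N=\binom{n+k-3}{n}+n+1$. Consider the following polynomials in $\mathbb{C}[x_1,\dots,x_n]$: - all $\binom{n+k-3}{n}$ monomials of (total) degree at most $k-3$; - the $n-1$ binomials $x_{i+1}^{k-1}-x_i^{k-2}$ for $i=1,\dots,n-1$; - the two monomials $x_1^{k-1}$ and $x_n^{k-2}$. There are $N$ of them, and the polynomial map $\mathbb{C}^n\to\mathbb{C}^{N}$ having them (in any order) as its coordinates is $k$-regular, that is, it is continuous and the images of any $k$ distinct points of $\mathbb{C}^n$ are linearly independent over $\mathbb{C}$. -/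

import Mathlib

/-- A map `f` from a topological space to `ℂ^N` is `k`-regular if it is continuous and sends any
`k` distinct points to linearly independent vectors. -/
def IsKRegular {X : Type*} [TopologicalSpace X] {N : ℕ} (k : ℕ) (f : X → Fin N → ℂ) : Prop :=
  Continuous f ∧
    ∀ P : Fin k → X, Function.Injective P → LinearIndependent ℂ (fun i => f (P i))

/-- The map `ℂ^n → ℂ^N` whose coordinates are the given `N` polynomials. -/
noncomputable def polynomialMap {n N : ℕ} (p : Fin N → MvPolynomial (Fin n) ℂ) :
    (Fin n → ℂ) → (Fin N → ℂ) :=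
  fun x j => MvPolynomial.eval x (p j)

/-- Exponents of the monomials of total degree at most `d` in `n` variables. -/
abbrev MonomialExponent (n d : ℕ) : Type :=
  {α : Fin n →₀ ℕ // α.degree ≤ d}

/-- Labels of the coordinates: the monomials of degree at most `k - 3`, the `n - 1` binomials,
and the two pure powers (`false` for the one of the first variable, `true` for the last). -/
abbrev CoordIndex (n k : ℕ) : Type :=
  MonomialExponent n (k - 3) ⊕ Fin (n - 1) ⊕ Bool

/-- The coordinate polynomial with a given label. The variables `x_1, …, x_n` are
`X 0, …, X (n - 1)`; the binomials are `x_{i+1}^{k-1} - x_i^{k-2}`, and the two pure powers are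
`x_1^{k-1}` and `x_n^{k-2}`. -/
noncomputable def coordPoly (n k : ℕ) (hn : 1 ≤ n) :
    CoordIndex n k → MvPolynomial (Fin n) ℂ
  | .inl α => MvPolynomial.monomial α.1 1
  | .inr (.inl i) =>
      MvPolynomial.X ⟨i.1 + 1, by omega⟩ ^ (k - 1) - MvPolynomial.X ⟨i.1, by omega⟩ ^ (k - 2)
  | .inr (.inr false) => MvPolynomial.X ⟨0, by omega⟩ ^ (k - 1)
  | .inr (.inr true) => MvPolynomial.X ⟨n - 1, by omega⟩ ^ (k - 2)

open Finset

/-! A linear dependency among `k` images is a combination of point evaluations killing all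
polynomials of degree at most `k - 3`. Multiplying by affine forms trades one degree for the points
on a line; counting then makes the support collinear (`AnnihilatesDegree.exists_line`). With support
points `p + t i • v`, the moments `∑ c i * t i ^ j` vanish for `j ≤ k - 3`. If moment `k - 2` also
vanishes, the binomials and the power of the first variable kill moment `k - 1`, and interpolation
gives `c = 0`. Otherwise, descending from the last variable, the binomials force `v = 0`. -/

/-- The number of monomials of degree at most `d` in `n` variables. -/
theorem card_monomialExponent (n d : ℕ) :
    Nat.card (MonomialExponent n d) = (n + d).choose n := by
  -- The extra coordinate is the slack `d - degree`.
  let e : MonomialExponent n d ≃ {P : Fin (n + 1) → ℕ // ∑ i, P i = d} :=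
    { toFun := fun α => ⟨Fin.cons (d - α.1.degree) α.1, by
        have := α.2
        rw [Fin.sum_univ_succ]
        simp only [Fin.cons_zero, Fin.cons_succ, ← Finsupp.degree_eq_sum]
        omega⟩
      invFun := fun P => ⟨Finsupp.equivFunOnFinite.symm (Fin.tail P.1), by
        have := P.2
        rw [Fin.sum_univ_succ] at this
        simp only [Finsupp.degree_eq_sum, Finsupp.equivFunOnFinite_symm_apply_apply, Fin.tail]
        omega⟩
      left_inv := fun α => by
        ext i
        simp
      right_inv := fun P => by
        have := P.2
        rw [Fin.sum_univ_succ] at this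
        ext i
        refine Fin.cases ?_ (fun j => ?_) i
        · simp only [Fin.cons_zero, Finsupp.degree_eq_sum,
            Finsupp.equivFunOnFinite_symm_apply_apply, Fin.tail]
          omega
        · simp [Fin.tail] }
  rw [Nat.card_congr (e.trans (Sym.equivNatSumOfFintype (Fin (n + 1)) d).symm),
    Sym.natCard_sym_eq_choose, Nat.card_fin, Nat.add_right_comm, Nat.add_sub_cancel]
  exact Nat.choose_symm_add.symm

theorem card_coordIndex (n k : ℕ) (hn : 1 ≤ n) (hk : 4 < k) :
    Nat.card (CoordIndex n k) = (n + k - 3).choose n + n + 1 := by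
  have : Finite (MonomialExponent n (k - 3)) := Finsupp.finite_of_degree_le (k - 3)
  rw [Nat.card_sum, Nat.card_sum, card_monomialExponent, Nat.card_fin, Nat.card_eq_fintype_card,
    Fintype.card_bool, show n + (k - 3) = n + k - 3 by omega]
  omega

/-! ### Combinations of point evaluations and their supports -/

section PointFunctionals

variable {K σ ι : Type*} [Field K] [Fintype ι]

/-- The linear functional `∑ i, c i • ev (P i)` vanishes on all polynomials of degree at most
`d`. -/
def AnnihilatesDegree (P : ι → σ → K) (c : ι → K) (d : ℕ) : Prop :=
  ∀ f : MvPolynomial σ K, f.totalDegree ≤ d → ∑ i, c i * MvPolynomial.eval (P i) f = 0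

theorem AnnihilatesDegree.mul_eval {P : ι → σ → K} {c : ι → K} {d : ℕ}
    (h : AnnihilatesDegree P c (d + 1)) {l : MvPolynomial σ K} (hl : l.totalDegree ≤ 1) :
    AnnihilatesDegree P (fun i => c i * MvPolynomial.eval (P i) l) d := by
  intro f hf
  have := h (l * f) ((MvPolynomial.totalDegree_mul _ _).trans (by omega))
  simpa [mul_assoc] using this

theorem annihilatesDegree_of_monomials {P : ι → σ → K} {c : ι → K} {d : ℕ}
    (h : ∀ α : σ →₀ ℕ, α.degree ≤ d →
      ∑ i, c i * MvPolynomial.eval (P i) (MvPolynomial.monomial α 1) = 0) :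
    AnnihilatesDegree P c d := by
  intro f hf
  conv_lhs => rw [f.as_sum]
  simp only [map_sum, mul_sum]
  rw [sum_comm]
  refine sum_eq_zero fun α hα => ?_
  have := h α ((MvPolynomial.le_totalDegree hα).trans hf)
  have h2 := congrArg (fun z => MvPolynomial.coeff α f * z) this
  simp only [mul_sum, mul_zero] at h2
  rw [← h2]
  refine sum_congr rfl fun i _ => ?_
  simp only [MvPolynomial.eval_monomial]
  ring

/-- A polynomial of degree at most one vanishing on the line `p + K v` and not at `r`. -/
theorem exists_linear_separating [Fintype σ] (p v r : σ → K) (hr : r - p ∉ Submodule.span K {v}) :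
    ∃ l : MvPolynomial σ K, l.totalDegree ≤ 1 ∧
      (∀ t : K, MvPolynomial.eval (p + t • v) l = 0) ∧ MvPolynomial.eval r l ≠ 0 := by
  classical
  obtain ⟨φ, hφ, hker⟩ := Submodule.exists_le_ker_of_notMem hr
  have hv : φ v = 0 := hker (Submodule.mem_span_singleton_self v)
  refine ⟨∑ i, MvPolynomial.C (φ (Pi.single i 1)) * (MvPolynomial.X i - MvPolynomial.C (p i)),
    ?_, ?_⟩
  · refine MvPolynomial.totalDegree_finsetSum_le fun i _ => ?_
    refine (MvPolynomial.totalDegree_mul _ _).trans ?_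
    rw [MvPolynomial.totalDegree_C, zero_add]
    refine (MvPolynomial.totalDegree_sub _ _).trans ?_
    simp
  · have key : ∀ x : σ → K, MvPolynomial.eval x (∑ i, MvPolynomial.C (φ (Pi.single i 1)) *
        (MvPolynomial.X i - MvPolynomial.C (p i))) = φ (x - p) := by
      intro x
      rw [LinearMap.pi_apply_eq_sum_univ φ (x - p)]
      have hsingle : ∀ i : σ, (fun j => if i = j then (1 : K) else 0) = Pi.single i 1 := by
        intro i
        ext j
        simp [Pi.single_apply, eq_comm]
      simp [mul_comm, hsingle]
    refine ⟨fun t => ?_, ?_⟩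
    · rw [key]; simp [hv]
    · rw [key]; exact hφ

variable [DecidableEq K]

/-- The set of indices at which `c` does not vanish. -/
def coeffSupport (c : ι → K) : Finset ι := univ.filter fun i => c i ≠ 0

theorem mem_coeffSupport {c : ι → K} {i : ι} : i ∈ coeffSupport c ↔ c i ≠ 0 := by
  simp [coeffSupport]

variable [Fintype σ]

/-- Multiplying by a linear form vanishing on the line through `P p` with direction `v` and not at
`P r` removes all points of that line from the support, keeps `r`, and lowers the degree by one. -/
theorem AnnihilatesDegree.exists_residual {P : ι → σ → K} {c : ι → K} {d : ℕ}
    (h : AnnihilatesDegree P c (d + 1)) (p : ι) (v : σ → K) {r : ι} (hr : c r ≠ 0)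
    (hrv : P r - P p ∉ Submodule.span K {v}) :
    ∃ c' : ι → K, AnnihilatesDegree P c' d ∧ c' r ≠ 0 ∧ coeffSupport c' ⊆ coeffSupport c ∧
      ∀ i ∈ coeffSupport c', P i - P p ∉ Submodule.span K {v} := by
  obtain ⟨l, hl, hline, hlr⟩ := exists_linear_separating (P p) v (P r) hrv
  refine ⟨_, h.mul_eval hl, mul_ne_zero hr hlr, fun i hi => ?_, fun i hi hmem => ?_⟩
  · rw [mem_coeffSupport] at hi ⊢
    exact left_ne_zero_of_mul hi
  · rw [mem_coeffSupport] at hi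
    obtain ⟨t, ht⟩ := Submodule.mem_span_singleton.1 hmem
    apply right_ne_zero_of_mul hi
    rw [show P i = P p + t • v by rw [ht]; abel]
    exact hline t

/-- A nonzero combination of point evaluations annihilating degree `d` involves at least `d + 2`
points. -/
theorem AnnihilatesDegree.card_support {P : ι → σ → K} (hP : Function.Injective P) {d : ℕ} :
    ∀ {c : ι → K}, AnnihilatesDegree P c d → ∀ {r : ι}, c r ≠ 0 →
      d + 2 ≤ (coeffSupport c).card := by
  have two : ∀ {c : ι → K} {e : ℕ}, AnnihilatesDegree P c e → ∀ {r : ι}, c r ≠ 0 →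
      ∃ q ∈ coeffSupport c, q ≠ r := by
    intro c e h r hr
    by_contra! hcon
    have h1 := h 1 (by simp)
    rw [Fintype.sum_eq_single r (fun i hi => ?_)] at h1
    · exact hr (by simpa using h1)
    · have : i ∉ coeffSupport c := fun hm => hi (hcon i hm)
      rw [mem_coeffSupport, not_not] at this
      simp [this]
  induction d with
  | zero =>
    intro c h r hr
    obtain ⟨q, hq, hqr⟩ := two h hr
    exact one_lt_card.2 ⟨q, hq, r, mem_coeffSupport.2 hr, hqr⟩
  | succ d ih =>
    intro c h r hr
    obtain ⟨q, hq, hqr⟩ := two h hr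
    -- Direction `0` shrinks the line to the single point `P q`.
    obtain ⟨c', h', hr', hsub, hoff⟩ := h.exists_residual q 0 hr (by
      simpa [sub_eq_zero] using fun he => hqr (hP he).symm)
    have hq' : q ∉ coeffSupport c' := fun hm => hoff q hm (by simp)
    have := card_lt_card (Finset.ssubset_iff_subset_ne.2 ⟨hsub, fun he => hq' (he ▸ hq)⟩)
    have := ih h' hr'
    omega

/-- If a combination of point evaluations annihilates degree `d` and its points are not all on the
line through two of them, there is a residual combination avoiding both. -/
theorem AnnihilatesDegree.exists_residual_pair [DecidableEq ι] {P : ι → σ → K} {c : ι → K} {d : ℕ}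
    (h : AnnihilatesDegree P c (d + 1)) (p q : ι) {r : ι} (hr : c r ≠ 0)
    (hrv : P r - P p ∉ Submodule.span K {P q - P p}) :
    ∃ c' : ι → K, AnnihilatesDegree P c' d ∧ c' r ≠ 0 ∧
      coeffSupport c' ⊆ ((coeffSupport c).erase p).erase q ∧
      ∀ i ∈ coeffSupport c', P i - P p ∉ Submodule.span K {P q - P p} := by
  obtain ⟨c', h', hr', hsub, hoff⟩ := h.exists_residual p (P q - P p) hr hrv
  refine ⟨c', h', hr', fun i hi => ?_, hoff⟩
  refine mem_erase.2 ⟨?_, mem_erase.2 ⟨?_, hsub hi⟩⟩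
  · rintro rfl
    exact hoff i hi (Submodule.mem_span_singleton_self _)
  · rintro rfl
    exact hoff i hi (by simp)

/-- At most `d + 3` points in the support of a combination of evaluations annihilating degree
`d ≥ 2` are collinear. -/
theorem AnnihilatesDegree.exists_line [DecidableEq ι] {P : ι → σ → K} (hP : Function.Injective P) {c : ι → K}
    {d : ℕ} (h : AnnihilatesDegree P c (d + 2)) (hcard : (coeffSupport c).card ≤ d + 5)
    {s : ι} (hs : c s ≠ 0) :
    ∃ p q : ι, p ≠ q ∧ ∀ i ∈ coeffSupport c, P i - P p ∈ Submodule.span K {P q - P p} := by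
  by_contra! hcon
  have pair : ∀ {c' : ι → K} {e : ℕ}, AnnihilatesDegree P c' e → ∀ {r : ι}, c' r ≠ 0 →
      ∃ p ∈ coeffSupport c', ∃ q ∈ coeffSupport c', p ≠ q := fun h' _ hr' =>
    one_lt_card.1 (lt_of_lt_of_le (by omega) (h'.card_support hP hr'))
  obtain ⟨p, hp, q, hq, hpq⟩ := pair h hs
  obtain ⟨r, hr, hrv⟩ := hcon p q hpq
  obtain ⟨c₁, h₁, hr₁, hsub₁, -⟩ :=
    h.exists_residual_pair p q (mem_coeffSupport.1 hr) hrv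
  have hcard₁ := card_le_card hsub₁
  rw [card_erase_of_mem (mem_erase.2 ⟨hpq.symm, hq⟩), card_erase_of_mem hp] at hcard₁
  have hlow₁ := h₁.card_support hP hr₁
  obtain ⟨p', hp', q', hq', hpq'⟩ := pair h₁ hr₁
  -- Otherwise a second residual would annihilate degree `d` with at most `d + 1` points.
  have hline : ∀ i ∈ coeffSupport c₁, P i - P p' ∈ Submodule.span K {P q' - P p'} := by
    by_contra! hex
    obtain ⟨r', hr', hrv'⟩ := hex
    obtain ⟨c₂, h₂, hr₂, hsub₂, -⟩ :=
      h₁.exists_residual_pair p' q' (mem_coeffSupport.1 hr') hrv'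
    have hcard₂ := card_le_card hsub₂
    rw [card_erase_of_mem (mem_erase.2 ⟨hpq'.symm, hq'⟩), card_erase_of_mem hp'] at hcard₂
    have := h₂.card_support hP hr₂
    omega
  obtain ⟨r', hr', hrv'⟩ := hcon p' q' hpq'
  -- The line contains the `d + 3` points of `c₁`, so at most two points survive, too few for degree
  -- `d + 1`.
  obtain ⟨c₃, h₃, hr₃, hsub₃, hoff⟩ := h.exists_residual p' (P q' - P p')
    (mem_coeffSupport.1 hr') hrv'
  have hsub : coeffSupport c₃ ⊆ coeffSupport c \ coeffSupport c₁ := fun i hi =>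
    mem_sdiff.2 ⟨hsub₃ hi, fun hm => hoff i hi (hline i hm)⟩
  have hle := card_le_card hsub
  rw [card_sdiff_of_subset fun i hi => mem_of_mem_erase (mem_of_mem_erase (hsub₁ hi))] at hle
  have := h₃.card_support hP hr₃
  omega

end PointFunctionals

/-! ### Moments on a line -/

/-- If the moments of order less than `m` vanish, only the coefficient of degree `m` of a
polynomial of degree at most `m` matters. -/
theorem sum_mul_eval_eq_coeff_mul_moment {K ι : Type*} [Field K] [Fintype ι] (c t : ι → K) (m : ℕ)
    (hM : ∀ j < m, ∑ i, c i * t i ^ j = 0) (f : Polynomial K) (hf : f.natDegree ≤ m) :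
    ∑ i, c i * f.eval (t i) = f.coeff m * ∑ i, c i * t i ^ m := by
  have : ∀ i, c i * f.eval (t i) = ∑ j ∈ range (m + 1), f.coeff j * (c i * t i ^ j) := by
    intro i
    rw [Polynomial.eval_eq_sum_range' (Nat.lt_succ_of_le hf), mul_sum]
    exact sum_congr rfl fun j _ => by ring
  simp only [this]
  rw [sum_comm, sum_range_succ]
  simp only [← mul_sum]
  rw [sum_eq_zero fun j hj => by rw [hM j (mem_range.1 hj), mul_zero], zero_add]

/-- The combination of `m`-th powers of an affine function when the lower moments vanish. -/
theorem sum_mul_affine_pow {K ι : Type*} [Field K] [Fintype ι] (c t : ι → K) (m : ℕ)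
    (hM : ∀ j < m, ∑ i, c i * t i ^ j = 0) (a v : K) :
    ∑ i, c i * (a + t i * v) ^ m = v ^ m * ∑ i, c i * t i ^ m := by
  have hd : (Polynomial.C v * Polynomial.X + Polynomial.C a).natDegree ≤ 1 :=
    Polynomial.natDegree_linear_le
  have h := sum_mul_eval_eq_coeff_mul_moment c t m hM
    ((Polynomial.C v * Polynomial.X + Polynomial.C a) ^ m)
    (by simpa using Polynomial.natDegree_pow_le_of_le m hd)
  have hc := Polynomial.coeff_pow_of_natDegree_le (m := m) hd
  rw [mul_one] at hc
  rw [hc] at h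
  simp only [Polynomial.eval_pow, Polynomial.eval_add, Polynomial.eval_mul, Polynomial.eval_C,
    Polynomial.eval_X, Polynomial.coeff_add, Polynomial.coeff_C_mul, Polynomial.coeff_X_one,
    Polynomial.coeff_C_succ, mul_one, add_zero] at h
  rw [← h]
  exact sum_congr rfl fun i _ => by rw [add_comm a, mul_comm v]

/-- A combination of evaluations at distinct points with vanishing moments is trivial. -/
theorem eq_zero_of_moments_eq_zero {K ι : Type*} [Field K] [Fintype ι] [DecidableEq ι]
    [DecidableEq K] (c t : ι → K)
    (ht : ∀ i ∈ coeffSupport c, ∀ j ∈ coeffSupport c, t i = t j → i = j) (m : ℕ)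
    (hm : (coeffSupport c).card ≤ m) (hM : ∀ j < m, ∑ i, c i * t i ^ j = 0) : c = 0 := by
  funext r
  by_contra hr
  have hrm : r ∈ coeffSupport c := mem_coeffSupport.2 hr
  -- Lagrange-type product, vanishing at every support node except `t r`.
  let f : Polynomial K := ∏ j ∈ (coeffSupport c).erase r, (Polynomial.X - Polynomial.C (t j))
  have hf : f.natDegree + 1 ≤ m := by
    rw [Polynomial.natDegree_prod_of_monic _ _ fun j _ => Polynomial.monic_X_sub_C _]
    simp only [Polynomial.natDegree_X_sub_C, sum_const, smul_eq_mul, mul_one]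
    rw [card_erase_add_one hrm]
    exact hm
  have h := sum_mul_eval_eq_coeff_mul_moment c t f.natDegree (fun j hj => hM j (by omega)) f le_rfl
  rw [hM _ (by omega), mul_zero, Fintype.sum_eq_single r] at h
  · refine mul_ne_zero hr ?_ h
    rw [Polynomial.eval_prod]
    refine prod_ne_zero_iff.2 fun j hj => ?_
    obtain ⟨hjr, hj⟩ := mem_erase.1 hj
    simpa [sub_eq_zero] using fun he => hjr (ht r hrm j hj he).symm
  · intro i hi
    by_cases hc : c i = 0
    · rw [hc, zero_mul]
    · rw [Polynomial.eval_prod, prod_eq_zero (mem_erase.2 ⟨hi, mem_coeffSupport.2 hc⟩) (by simp),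
        mul_zero]

/-! ### Triviality of dependencies -/

theorem eq_zero_of_sum_mul_coordPoly_eq_zero (n k : ℕ) (hn : 1 ≤ n) (hk : 4 < k)
    (P : Fin k → Fin n → ℂ) (hP : Function.Injective P) (c : Fin k → ℂ)
    (h : ∀ b, ∑ i, c i * MvPolynomial.eval (P i) (coordPoly n k hn b) = 0) : c = 0 := by
  classical
  obtain ⟨d, rfl⟩ : ∃ d, k = d + 5 := ⟨k - 5, by omega⟩
  have hann : AnnihilatesDegree P c (d + 2) :=
    annihilatesDegree_of_monomials fun α hα => h (.inl ⟨α, hα⟩)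
  have hfirst : ∑ i, c i * P i ⟨0, by omega⟩ ^ (d + 4) = 0 := by
    simpa [coordPoly] using h (.inr (.inr false))
  have hlast : ∑ i, c i * P i ⟨n - 1, by omega⟩ ^ (d + 3) = 0 := by
    simpa [coordPoly] using h (.inr (.inr true))
  have hstep : ∀ (j : ℕ) (hj : j + 1 < n), ∑ i, c i * P i ⟨j + 1, hj⟩ ^ (d + 4) =
      ∑ i, c i * P i ⟨j, by omega⟩ ^ (d + 3) := by
    intro j hj
    have := h (.inr (.inl ⟨j, by omega⟩))
    simpa [coordPoly, mul_sub, sub_eq_zero] using this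
  by_contra hc
  obtain ⟨s, hs⟩ := Function.ne_iff.1 hc
  have hcard : (coeffSupport c).card ≤ d + 5 := by
    simpa using card_le_univ (coeffSupport c)
  obtain ⟨p, q, hpq, hline⟩ := hann.exists_line hP hcard hs
  set v := P q - P p with hv
  obtain ⟨w, hw⟩ : ∃ w, v w ≠ 0 := Function.ne_iff.1 (sub_ne_zero.2 fun he => hpq (hP he).symm)
  let t : Fin (d + 5) → ℂ := fun i => (P i w - P p w) / v w
  have hPt : ∀ i ∈ coeffSupport c, P i = fun x => P p x + t i * v x := by
    intro i hi
    obtain ⟨u, hu⟩ := Submodule.mem_span_singleton.1 (hline i hi)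
    have hut : u = t i := by
      have := congrFun hu w
      simp only [Pi.smul_apply, smul_eq_mul, Pi.sub_apply] at this
      rw [eq_div_iff hw, this]
    funext x
    have := congrFun hu x
    simp only [Pi.smul_apply, smul_eq_mul, Pi.sub_apply] at this
    rw [← hut, this]
    ring
  have hcoord : ∀ x m, ∑ i, c i * P i x ^ m = ∑ i, c i * (P p x + t i * v x) ^ m := by
    intro x m
    refine sum_congr rfl fun i _ => ?_
    by_cases hi : c i = 0
    · simp [hi]
    · rw [congrFun (hPt i (mem_coeffSupport.2 hi)) x]
  have hinj : ∀ i ∈ coeffSupport c, ∀ j ∈ coeffSupport c, t i = t j → i = j := by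
    intro i hi j hj he
    apply hP
    rw [hPt i hi, hPt j hj, he]
  have hM : ∀ j < d + 3, ∑ i, c i * t i ^ j = 0 := by
    intro j hj
    have := hann ((MvPolynomial.C (v w)⁻¹ * (MvPolynomial.X w - MvPolynomial.C (P p w))) ^ j) (by
      refine (MvPolynomial.totalDegree_pow _ _).trans ?_
      have h1 : (MvPolynomial.C (v w)⁻¹ *
          (MvPolynomial.X w - MvPolynomial.C (P p w))).totalDegree ≤ 1 := by
        refine (MvPolynomial.totalDegree_mul _ _).trans ?_
        rw [MvPolynomial.totalDegree_C, zero_add]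
        refine (MvPolynomial.totalDegree_sub _ _).trans ?_
        simp
      exact (Nat.mul_le_mul_left j h1).trans (by omega))
    simpa [t, div_eq_inv_mul] using this
  have hpow₃ : ∀ x, ∑ i, c i * P i x ^ (d + 3) = v x ^ (d + 3) * ∑ i, c i * t i ^ (d + 3) :=
    fun x => by rw [hcoord, sum_mul_affine_pow c t _ hM]
  by_cases hM₃ : ∑ i, c i * t i ^ (d + 3) = 0
  · have hM' : ∀ j < d + 4, ∑ i, c i * t i ^ j = 0 := fun j hj => by
      rcases Nat.lt_succ_iff_lt_or_eq.1 hj with hj | rfl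
      · exact hM j hj
      · exact hM₃
    have hpow₄ : ∀ x, ∑ i, c i * P i x ^ (d + 4) = v x ^ (d + 4) * ∑ i, c i * t i ^ (d + 4) :=
      fun x => by rw [hcoord, sum_mul_affine_pow c t _ hM']
    have hzero : ∀ x, ∑ i, c i * P i x ^ (d + 4) = 0 := by
      rintro ⟨_ | j, hj⟩
      · exact hfirst
      · rw [hstep j hj, hpow₃, hM₃, mul_zero]
    have hM₄ : ∑ i, c i * t i ^ (d + 4) = 0 :=
      (mul_eq_zero.1 ((hpow₄ w).symm.trans (hzero w))).resolve_left (pow_ne_zero _ hw)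
    refine hc (eq_zero_of_moments_eq_zero c t hinj (d + 5) hcard fun j hj => ?_)
    rcases Nat.lt_succ_iff_lt_or_eq.1 hj with hj | rfl
    · exact hM' j hj
    · exact hM₄
  · have hvzero : ∀ x, ∑ i, c i * P i x ^ (d + 3) = 0 → v x = 0 := fun x hx =>
      pow_eq_zero_iff (by omega) |>.1 ((mul_eq_zero.1 ((hpow₃ x).symm.trans hx)).resolve_right hM₃)
    have hall : ∀ m (hm : m < n), v ⟨n - 1 - m, by omega⟩ = 0 := by
      intro m
      induction m with
      | zero => exact fun _ => hvzero _ hlast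
      | succ m ih =>
        intro hm
        apply hvzero
        -- The next variable is constant on the support since its component of `v` is zero, so its
        -- power sum is a multiple of `∑ c i = 0`.
        rw [← hstep (n - 1 - (m + 1)) (by omega), hcoord]
        have hprev := ih (by omega)
        have hidx : (⟨n - 1 - (m + 1) + 1, by omega⟩ : Fin n) = ⟨n - 1 - m, by omega⟩ :=
          Fin.ext (by simp only; omega)
        rw [hidx, hprev]
        have h0 := hM 0 (by omega)
        simp only [pow_zero, mul_one] at h0
        simp only [mul_zero, add_zero]
        rw [← sum_mul, h0, zero_mul]
    have hw' := hall (n - 1 - w.1) (by omega)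
    have hidx : (⟨n - 1 - (n - 1 - w.1), by omega⟩ : Fin n) = w := Fin.ext (by simp only; omega)
    exact hw (hidx ▸ hw')

theorem continuous_polynomialMap {n N : ℕ} (p : Fin N → MvPolynomial (Fin n) ℂ) :
    Continuous (polynomialMap p) :=
  continuous_pi fun j => (p j).continuous_eval

theorem mainTheorem3 (n k : ℕ) (hn : 1 ≤ n) (hk : 4 < k) :
    Nat.card (CoordIndex n k) = (n + k - 3).choose n + n + 1 ∧
    ∀ e : Fin ((n + k - 3).choose n + n + 1) ≃ CoordIndex n k,
      IsKRegular k (polynomialMap (fun j => coordPoly n k hn (e j))) := by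
  refine ⟨card_coordIndex n k hn hk, fun e => ⟨continuous_polynomialMap _, fun P hP => ?_⟩⟩
  rw [Fintype.linearIndependent_iff]
  intro c hc
  refine congrFun (eq_zero_of_sum_mul_coordPoly_eq_zero n k hn hk P hP c fun b => ?_)
  have := congrFun hc (e.symm b)
  simpa [polynomialMap] using this
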